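/- Let $\tau$ be in the upper half-plane, $z\in\mathbb{C}$, $q=e^{2\pi i\tau}$, $y=e^{2\pi i z}$. Let $E_4(\tau)=1+240\sum_{n\ge1}\sigma_3(n)q^n$ and $E_6(\tau)=1-504\sum_{n\ge1}\sigma_5(n)q^n$ be the normalized Eisenstein series of $\mathrm{SL}(2,\mathbb{Z})$, let $\eta(\tau)=q^{1/24}\prod_{n\ge1}(1-q^n)$, and put $$E_2^{(2)}(\tau)=-\frac{24}{2\pi i}\,\partial_\tau\log\frac{\eta(\tau)}{\eta(2\tau)}.$$ With the Jacobi theta functions $$\theta_1(\tau,z)=-i\sum_{n\in\mathbb{Z}}(-1)^n q^{\frac12(n+\frac12)^2}y^{n+\frac12},\quad \theta_2(\tau,z)=\sum_{n\in\mathbb{Z}}q^{\frac12(n+\frac12)^2}y^{n+\frac12},\quad \theta_3(\tau,z)=\sum_{n\in\mathbb{Z}}q^{\frac12n^2}y^{n},\quad \theta_4(\tau,z)=\sum_{n\in\mathbb{Z}}(-1)^nq^{\frac12n^2}y^{n}$$ (where $q^{s}$ and $y^{s}$ mean $e^{2\pi i s\tau}$ and $e^{2\pi i s z}$), define the weak Jacobi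 forms $$A(\tau,z)=\varphi_{-2,1}(\tau,z)=\frac{\theta_1(\tau,z)^2}{\eta(\tau)^6},\qquad B(\tau,z)=\varphi_{0,1}(\tau,z)=4\left(\frac{\theta_2(\tau,z)^2}{\theta_2(\tau,0)^2}+\frac{\theta_3(\tau,z)^2}{\theta_3(\tau,0)^2}+\frac{\theta_4(\tau,z)^2}{\theta_4(\tau,0)^2}\right).$$ Write $\widehat E_4=E_4(2\tau)$, $\widehat E_6=E_6(2\tau)$, $\widehat A=A(2\tau,z)$, $\widehat B=B(2\tau,z)$. Then for all $\tau$ and $z$ $$\widehat E_4=\tfrac54\bigl(E_2^{(2)}\bigr)^2-\tfrac14E_4,\qquad \widehat E_6=\tfrac78\bigl(E_2^{(2)}\bigr)^3+\tfrac18E_6,$$ $$A=\tfrac1{12}\widehat A\,\widehat B+\tfrac1{12}E_2^{(2)}\widehat A^{\,2},\qquad B=\tfrac1{12}\widehat B\bigl(E_2^{(2)}\widehat A+\widehat B\bigr)-\tfrac1{16}\widehat A^{\,2}\Bigl(\bigl(E_2^{(2)}\bigr)^2-E_4\Bigr),$$ where the unhatted forms are evaluated at $\tau$, respectively at $(\tau,z)$.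 -/

import Mathlib

open Complex
open UpperHalfPlane hiding I
open scoped Real

noncomputable section

namespace LevelTwo

/-- The point `N * τ` of the upper half-plane, for a positive integer `N`. -/
def mulPt (N : ℕ) [NeZero N] (τ : ℍ) : ℍ :=
  ⟨(N : ℂ) * (τ : ℂ), by
    simpa using mul_pos (Nat.cast_pos.mpr (Nat.pos_of_ne_zero (NeZero.ne N))) τ.im_pos⟩

/-- `θ₁(τ, z) = -i ∑_{n ∈ ℤ} (-1)ⁿ q^{(n + 1/2)² / 2} y^{n + 1/2}`,
with `q = e^{2 π i τ}` and `y = e^{2 π i z}`. -/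
def theta1 (τ : ℍ) (z : ℂ) : ℂ :=
  -I * ∑' n : ℤ, (-1 : ℂ) ^ n *
    cexp (π * I * ((n : ℂ) + 1 / 2) ^ 2 * τ + 2 * π * I * ((n : ℂ) + 1 / 2) * z)

/-- `θ₂(τ, z) = ∑_{n ∈ ℤ} q^{(n + 1/2)² / 2} y^{n + 1/2}`. -/
def theta2 (τ : ℍ) (z : ℂ) : ℂ :=
  ∑' n : ℤ, cexp (π * I * ((n : ℂ) + 1 / 2) ^ 2 * τ + 2 * π * I * ((n : ℂ) + 1 / 2) * z)

/-- `θ₃(τ, z) = ∑_{n ∈ ℤ} q^{n² / 2} yⁿ`. -/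
def theta3 (τ : ℍ) (z : ℂ) : ℂ :=
  ∑' n : ℤ, cexp (π * I * (n : ℂ) ^ 2 * τ + 2 * π * I * (n : ℂ) * z)

/-- `θ₄(τ, z) = ∑_{n ∈ ℤ} (-1)ⁿ q^{n² / 2} yⁿ`. -/
def theta4 (τ : ℍ) (z : ℂ) : ℂ :=
  ∑' n : ℤ, (-1 : ℂ) ^ n * cexp (π * I * (n : ℂ) ^ 2 * τ + 2 * π * I * (n : ℂ) * z)

/-- The weight two Eisenstein series of level `N`,
`E₂^{(N)}(τ) = -(24 / (N - 1)) (1 / (2 π i)) ∂_τ log (η(τ) / η(N τ))`. -/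
def E2level (N : ℕ) (τ : ℍ) : ℂ :=
  -(24 / ((N : ℂ) - 1)) * (1 / (2 * π * I)) *
    logDeriv (fun w : ℂ => ModularForm.eta w / ModularForm.eta ((N : ℂ) * w)) (τ : ℂ)

/-- The weak Jacobi form `A = φ_{-2,1}`, normalised as `θ₁(τ, z)² / η(τ)⁶`. -/
def A (τ : ℍ) (z : ℂ) : ℂ := theta1 τ z ^ 2 / ModularForm.eta (τ : ℂ) ^ 6

/-- The weak Jacobi form `B = φ_{0,1}`. -/
def B (τ : ℍ) (z : ℂ) : ℂ :=
  4 * (theta2 τ z ^ 2 / theta2 τ 0 ^ 2 + theta3 τ z ^ 2 / theta3 τ 0 ^ 2 +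
    theta4 τ z ^ 2 / theta4 τ 0 ^ 2)

end LevelTwo

end

/-!
# Doubling the argument of `E₄`, `E₆`, `φ_{-2,1}` and `φ_{0,1}`

All four identities become polynomial identities once every function is written in terms of theta
functions at `2τ`.

*Theta functions.* Splitting the double series of `θ₃(τ, x) θ₃(τ, y)` according to the parity of the
sum of the two indices gives the addition formula
`θ₃(τ, x) θ₃(τ, y) = θ₃(2τ, x + y) θ₃(2τ, x - y) + θ₂(2τ, x + y) θ₂(2τ, x - y)`
(`jacobiTheta₂_mul_jacobiTheta₂`), and a shift by a half period gives its analogue for `θ₂`. Since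
`θ₄` and `θ₁` are the translates by `1/2` of `θ₃` and `-θ₂`, everything else follows by
specialising: the Landen transformations, which express `θᵢ(τ, z) θᵢ(τ, 0)` (or
`θ₁(τ, z) θ₂(τ, 0)`) through theta functions at `(2τ, z)`, and the Jacobi identities
(`jacobi_identities`), by which the squares `θᵢ(σ, z)²` lie in a plane.

*Modular forms.* The forms `E₂^{(2)}` and `(θ₃⁴ + θ₄⁴) / 2` each have three conjugates under
`SL(2, ℤ)`, permuted in the same way (`IsConjTriple`) and with the same limits at `i∞`. The
elementary symmetric functions of the differences of conjugates are forms of level one and weights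
2, 4, 6 vanishing at `i∞`, hence zero; so the two triples agree (`E2level_two_eq_theta`). The
symmetric functions of the theta triple itself give the classical expressions of `E₄` and `E₆` by
theta constants, and `E₄³ - E₆² = 1728 η²⁴` then gives `(θ₂ θ₃ θ₄)⁸ = 256 η²⁴`. To extract the
fourth root `(θ₂ θ₃ θ₄)² = 4 η⁶` (`theta_mul_sq_eq_eta_pow`), note that the quotient of the two
sides is constant by connectedness; comparing its values at `τ` and `2τ`, and letting `τ` tend to
`i∞`, pins the constant down.
-/

noncomputable section

namespace LevelTwo

/-! ### Theta functions and the addition formulas -/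

/-- The theta function `θ₂(τ, z)`, in the convention of `jacobiTheta₂`: the elliptic variable comes
first and the modular variable is a complex number. It is defined as the translate of
`jacobiTheta₂` (which is `θ₃`) by a half period, with the exponential factor that this entails. -/
def thetaTwo (z τ : ℂ) : ℂ := cexp (π * I * τ / 4 + π * I * z) * jacobiTheta₂ (z + τ / 2) τ

lemma theta3_eq (τ : ℍ) (z : ℂ) : theta3 τ z = jacobiTheta₂ z τ :=
  tsum_congr fun n ↦ by rw [jacobiTheta₂_term]; ring_nf

lemma theta2_eq (τ : ℍ) (z : ℂ) : theta2 τ z = thetaTwo z τ := by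
  rw [theta2, thetaTwo, jacobiTheta₂, ← tsum_mul_left]
  refine tsum_congr fun n ↦ ?_
  rw [jacobiTheta₂_term, ← Complex.exp_add]
  ring_nf

lemma exp_pi_mul_I_mul_int (n : ℤ) : cexp (π * I * n) = (-1) ^ n := by
  rw [mul_comm, Complex.exp_int_mul, Complex.exp_pi_mul_I]

lemma theta4_eq (τ : ℍ) (z : ℂ) : theta4 τ z = jacobiTheta₂ (z + 1 / 2) τ := by
  refine tsum_congr fun n ↦ ?_
  rw [jacobiTheta₂_term, ← exp_pi_mul_I_mul_int, ← Complex.exp_add]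
  ring_nf

lemma theta1_eq (τ : ℍ) (z : ℂ) : theta1 τ z = -thetaTwo (z + 1 / 2) τ := by
  rw [theta1, thetaTwo, jacobiTheta₂, ← tsum_mul_left, ← tsum_mul_left, ← tsum_neg]
  refine tsum_congr fun n ↦ ?_
  have hI : cexp (π * I / 2) = I := by
    rw [show (π * I / 2 : ℂ) = π / 2 * I by ring, Complex.exp_pi_div_two_mul_I]
  rw [jacobiTheta₂_term, ← Complex.exp_add, ← exp_pi_mul_I_mul_int, ← Complex.exp_add, neg_mul]
  nth_rw 1 [← hI]
  rw [← Complex.exp_add]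
  ring_nf

lemma summable_mul_jacobiTheta₂_term (x y : ℂ) {τ : ℂ} (hτ : 0 < τ.im) :
    Summable fun p : ℤ × ℤ ↦ jacobiTheta₂_term p.1 x τ * jacobiTheta₂_term p.2 y τ :=
  summable_mul_of_summable_norm (f := (jacobiTheta₂_term · x τ)) (g := (jacobiTheta₂_term · y τ))
    ((summable_jacobiTheta₂_term_iff x τ).2 hτ).norm
    ((summable_jacobiTheta₂_term_iff y τ).2 hτ).norm

lemma jacobiTheta₂_mul_eq_tsum (x y : ℂ) {τ : ℂ} (hτ : 0 < τ.im) :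
    jacobiTheta₂ x τ * jacobiTheta₂ y τ =
      ∑' p : ℤ × ℤ, jacobiTheta₂_term p.1 x τ * jacobiTheta₂_term p.2 y τ :=
  tsum_mul_tsum_of_summable_norm ((summable_jacobiTheta₂_term_iff x τ).2 hτ).norm
    ((summable_jacobiTheta₂_term_iff y τ).2 hτ).norm

/-- The addition formula for `θ₃`. Writing the indices of the double series as `(k + l, k - l)` when
their sum is even and as `(k + l + 1, k - l)` when it is odd separates the variables. -/
theorem jacobiTheta₂_mul_jacobiTheta₂ (x y : ℂ) {τ : ℂ} (hτ : 0 < τ.im) :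
    jacobiTheta₂ x τ * jacobiTheta₂ y τ =
      jacobiTheta₂ (x + y) (2 * τ) * jacobiTheta₂ (x - y) (2 * τ) +
        thetaTwo (x + y) (2 * τ) * thetaTwo (x - y) (2 * τ) := by
  have h2 : 0 < (2 * τ).im := by simpa using hτ
  let i₀ : ℤ × ℤ → ℤ × ℤ := fun p ↦ (p.1 + p.2, p.1 - p.2)
  let i₁ : ℤ × ℤ → ℤ × ℤ := fun p ↦ (p.1 + p.2 + 1, p.1 - p.2)
  have hi₀ : Function.Injective i₀ := fun p q h ↦ by
    simp only [i₀, Prod.mk.injEq] at h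
    ext <;> lia
  have hi₁ : Function.Injective i₁ := fun p q h ↦ by
    simp only [i₁, Prod.mk.injEq] at h
    ext <;> lia
  have hc : IsCompl (Set.range i₀) (Set.range i₁) := by
    refine ⟨Set.disjoint_iff_forall_ne.2 ?_, codisjoint_iff.2 (Set.eq_univ_of_forall ?_)⟩
    · rintro _ ⟨p, rfl⟩ _ ⟨q, rfl⟩ h
      simp only [i₀, i₁, Prod.mk.injEq] at h
      lia
    · rintro ⟨m, n⟩
      rcases Int.even_or_odd (m + n) with ⟨k, hk⟩ | ⟨k, hk⟩
      · exact Or.inl ⟨(k, m - k), by simp only [i₀, Prod.mk.injEq]; lia⟩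
      · exact Or.inr ⟨(k, m - k - 1), by simp only [i₁, Prod.mk.injEq]; lia⟩
  set F : ℤ × ℤ → ℂ := fun p ↦ jacobiTheta₂_term p.1 x τ * jacobiTheta₂_term p.2 y τ
  have hF : Summable F := summable_mul_jacobiTheta₂_term x y hτ
  -- The pairs of indices with even sum.
  have e₀ : HasSum (F ∘ i₀) (jacobiTheta₂ (x + y) (2 * τ) * jacobiTheta₂ (x - y) (2 * τ)) := by
    rw [jacobiTheta₂_mul_eq_tsum _ _ h2]
    convert! (summable_mul_jacobiTheta₂_term (x + y) (x - y) h2).hasSum using 1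
    ext p
    simp only [F, i₀, Function.comp_apply, jacobiTheta₂_term, ← Complex.exp_add]
    push_cast
    ring_nf
  -- The pairs of indices with odd sum.
  have e₁ : HasSum (F ∘ i₁) (thetaTwo (x + y) (2 * τ) * thetaTwo (x - y) (2 * τ)) := by
    rw [thetaTwo, thetaTwo, mul_mul_mul_comm, jacobiTheta₂_mul_eq_tsum _ _ h2]
    convert! (summable_mul_jacobiTheta₂_term
      (x + y + 2 * τ / 2) (x - y + 2 * τ / 2) h2).hasSum.mul_left
      (cexp (π * I * (2 * τ) / 4 + π * I * (x + y)) *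
        cexp (π * I * (2 * τ) / 4 + π * I * (x - y))) using 1
    ext p
    simp only [F, i₁, Function.comp_apply, jacobiTheta₂_term, ← Complex.exp_add]
    push_cast
    ring_nf
  rw [jacobiTheta₂_mul_eq_tsum x y hτ]
  exact (HasSum.add_isCompl (f := F) hc (hi₀.hasSum_range_iff.2 e₀)
    (hi₁.hasSum_range_iff.2 e₁)).tsum_eq

lemma jacobiTheta₂_half_period (z τ : ℂ) :
    jacobiTheta₂ (z + τ / 2) τ = cexp (-(π * I * τ / 4 + π * I * z)) * thetaTwo z τ := by
  rw [thetaTwo, ← mul_assoc, ← Complex.exp_add]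
  simp

lemma thetaTwo_half_period (z τ : ℂ) :
    thetaTwo (z + τ / 2) τ = cexp (-(π * I * τ / 4 + π * I * z)) * jacobiTheta₂ z τ := by
  rw [thetaTwo, show z + τ / 2 + τ / 2 = z + τ by ring, jacobiTheta₂_add_left', ← mul_assoc,
    ← Complex.exp_add]
  ring_nf

/-- The addition formula for `θ₂`: this is the one for `θ₃` with both variables translated by
`τ / 2`. -/
theorem thetaTwo_mul_thetaTwo (x y : ℂ) {τ : ℂ} (hτ : 0 < τ.im) :
    thetaTwo x τ * thetaTwo y τ =
      thetaTwo (x + y) (2 * τ) * jacobiTheta₂ (x - y) (2 * τ) +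
        jacobiTheta₂ (x + y) (2 * τ) * thetaTwo (x - y) (2 * τ) := by
  have h := jacobiTheta₂_mul_jacobiTheta₂ (x + τ / 2) (y + τ / 2) hτ
  have e₁ : x + τ / 2 + (y + τ / 2) = (x + y) + 2 * τ / 2 := by ring
  have e₂ : x + τ / 2 - (y + τ / 2) = x - y := by ring
  rw [e₁, e₂, jacobiTheta₂_half_period (x + y), thetaTwo_half_period (x + y)] at h
  have hexp : cexp (π * I * τ / 4 + π * I * x) * cexp (π * I * τ / 4 + π * I * y) *
      cexp (-(π * I * (2 * τ) / 4 + π * I * (x + y))) = 1 := by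
    rw [← Complex.exp_add, ← Complex.exp_add, ← Complex.exp_zero]
    ring_nf
  rw [thetaTwo, thetaTwo, mul_mul_mul_comm, h]
  linear_combination (thetaTwo (x + y) (2 * τ) * jacobiTheta₂ (x - y) (2 * τ) +
        jacobiTheta₂ (x + y) (2 * τ) * thetaTwo (x - y) (2 * τ)) * hexp

lemma thetaTwo_add_one (z τ : ℂ) : thetaTwo (z + 1) τ = -thetaTwo z τ := by
  rw [thetaTwo, thetaTwo, show z + 1 + τ / 2 = z + τ / 2 + 1 by ring, jacobiTheta₂_add_left,
    show (π * I * τ / 4 + π * I * (z + 1) : ℂ) = π * I * τ / 4 + π * I * z + π * I by ring,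
    Complex.exp_add _ (π * I), Complex.exp_pi_mul_I]
  ring

/-! ### Modular forms of level one from conjugate triples -/

section LevelOne
open Filter Topology ModularForm MatrixGroups

/-- Invariance under the generators `S` and `T`, holomorphy, and a limit at `i∞` suffice for a
function on the upper half-plane to be a modular form of level one. -/
lemma exists_levelOne_modularForm (k : ℕ) {f : ℂ → ℂ} {c : ℂ}
    (hd : DifferentiableOn ℂ f upperHalfPlaneSet)
    (hS : ∀ w : ℂ, 0 < w.im → f (-1 / w) = w ^ k * f w)
    (hT : ∀ w : ℂ, 0 < w.im → f (w + 1) = f w)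
    (hc : Tendsto f (comap Complex.im atTop) (𝓝 c)) :
    ∃ F : ModularForm 𝒮ℒ k, (∀ τ : ℍ, F τ = f τ) ∧ (qExpansion 1 F).coeff 0 = c := by
  set g : ℍ → ℂ := fun τ ↦ f τ
  have hlim : Tendsto g atImInfty (𝓝 c) := hc.comp UpperHalfPlane.tendsto_coe_atImInfty
  have hgS : g ∣[(k : ℤ)] ModularGroup.S = g := by
    ext τ
    have h0 := τ.ne_zero
    rw [ModularForm.SL_slash_apply, UpperHalfPlane.modular_S_smul, ModularGroup.denom_S]
    have := hS τ τ.im_pos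
    simp only [g]
    rw [show (-(τ : ℂ))⁻¹ = -1 / τ by rw [neg_div, one_div, inv_neg], this, zpow_neg, zpow_natCast]
    field_simp
  have hgT : g ∣[(k : ℤ)] ModularGroup.T = g := by
    ext τ
    have hden : denom (ModularGroup.T : GL (Fin 2) ℝ) (τ : ℂ) = 1 := by
      rw [ModularGroup.denom_apply]
      simp [ModularGroup.T]
    rw [ModularForm.SL_slash_apply, UpperHalfPlane.modular_T_smul, hden]
    simp [g, add_comm (1 : ℂ), hT τ τ.im_pos]
  have hslash := SlashInvariantForm.slash_action_generators_SL2Z hgS hgT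
  let F : ModularForm 𝒮ℒ k :=
    { toFun := g
      slash_action_eq' := by
        rintro _ ⟨A, rfl⟩
        exact hslash A
      holo' := by
        rw [UpperHalfPlane.mdifferentiable_iff]
        refine hd.congr fun z hz ↦ ?_
        simp [g, ofComplex_apply_of_im_pos hz]
      bdd_at_cusps' := fun {c'} hc' ↦ by
        rw [Subgroup.IsArithmetic.isCusp_iff_isCusp_SL2Z] at hc'
        rw [OnePoint.isBoundedAt_iff_forall_SL2Z hc']
        intro γ _
        rw [hslash]
        exact hlim.isBigO_one ℝ }
  refine ⟨F, fun _ ↦ rfl, ?_⟩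
  rw [UpperHalfPlane.qExpansion_coeff_zero one_pos
    (ModularFormClass.analyticAt_cuspFunction_zero F one_pos one_mem_strictPeriods_SL)
    (SlashInvariantFormClass.periodic_comp_ofComplex F one_mem_strictPeriods_SL)]
  exact hlim.limUnder_eq

lemma levelOne_eq_of_coeff_zero_eq {k : ℕ} (hk : k < 12) {F G : ModularForm 𝒮ℒ k}
    (h : (qExpansion 1 F).coeff 0 = (qExpansion 1 G).coeff 0) : F = G := by
  rw [← sub_eq_zero]
  apply ModularForm.sturm_bound_levelOne_nat
  rw [Nat.div_eq_of_lt hk, Nat.cast_zero, pos_iff_ne_zero,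
    PowerSeries.order_ne_zero_iff_constCoeff_eq_zero,
    ← PowerSeries.coeff_zero_eq_constantCoeff_apply, FunLike.coe_sub,
    ModularForm.qExpansion_sub one_pos one_mem_strictPeriods_SL, map_sub, h, sub_self]

lemma eq_zero_of_levelOne_weight_two {f : ℂ → ℂ} {c : ℂ}
    (hd : DifferentiableOn ℂ f upperHalfPlaneSet)
    (hS : ∀ w : ℂ, 0 < w.im → f (-1 / w) = w ^ 2 * f w)
    (hT : ∀ w : ℂ, 0 < w.im → f (w + 1) = f w)
    (hc : Tendsto f (comap Complex.im atTop) (𝓝 c)) (τ : ℍ) : f τ = 0 := by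
  obtain ⟨F, hF, -⟩ := exists_levelOne_modularForm 2 hd hS hT hc
  have : F = 0 := rank_zero_iff_forall_zero.mp ModularForm.levelOne_weight_two_rank_zero F
  rw [← hF, this]
  rfl

lemma eq_mul_E_of_levelOne {k : ℕ} (hk3 : 3 ≤ k) (hk : k < 12) (hk2 : Even k) {f : ℂ → ℂ} {c : ℂ}
    (hd : DifferentiableOn ℂ f upperHalfPlaneSet)
    (hS : ∀ w : ℂ, 0 < w.im → f (-1 / w) = w ^ k * f w)
    (hT : ∀ w : ℂ, 0 < w.im → f (w + 1) = f w)
    (hc : Tendsto f (comap Complex.im atTop) (𝓝 c)) (τ : ℍ) :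
    f τ = c * ModularForm.E hk3 τ := by
  obtain ⟨F, hF, hF0⟩ := exists_levelOne_modularForm k hd hS hT hc
  have : F = c • ModularForm.E hk3 := by
    apply levelOne_eq_of_coeff_zero_eq hk
    rw [hF0, FunLike.coe_smul, ModularForm.qExpansion_smul one_pos one_mem_strictPeriods_SL,
      PowerSeries.coeff_smul, EisensteinSeries.E_qExpansion_coeff_zero hk3 hk2, smul_eq_mul,
      mul_one]
  rw [← hF, this]
  rfl

/-- The functions `f`, `g`, `h` are holomorphic of weight two on the upper half-plane and are
permuted by `SL(2, ℤ)` like the three conjugates of a modular form `f` for `Γ₀(2)`: the generator `S`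
exchanges `f` and `g`, the generator `T` exchanges `g` and `h`. Moreover `f` tends to `a`, and `g`
and `h` tend to `b`, at `i∞`. Only the values at arguments of positive imaginary part matter. -/
structure IsConjTriple (f g h : ℂ → ℂ) (a b : ℂ) : Prop where
  diff_f : DifferentiableOn ℂ f upperHalfPlaneSet
  diff_g : DifferentiableOn ℂ g upperHalfPlaneSet
  diff_h : DifferentiableOn ℂ h upperHalfPlaneSet
  S_f : ∀ w : ℂ, 0 < w.im → f (-1 / w) = w ^ 2 * g w
  S_g : ∀ w : ℂ, 0 < w.im → g (-1 / w) = w ^ 2 * f w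
  S_h : ∀ w : ℂ, 0 < w.im → h (-1 / w) = w ^ 2 * h w
  T_f : ∀ w : ℂ, 0 < w.im → f (w + 1) = f w
  T_g : ∀ w : ℂ, 0 < w.im → g (w + 1) = h w
  T_h : ∀ w : ℂ, 0 < w.im → h (w + 1) = g w
  lim_f : Tendsto f (comap Complex.im atTop) (𝓝 a)
  lim_g : Tendsto g (comap Complex.im atTop) (𝓝 b)
  lim_h : Tendsto h (comap Complex.im atTop) (𝓝 b)

namespace IsConjTriple

variable {f g h f' g' h' : ℂ → ℂ} {a b a' b' : ℂ}

lemma sub (H : IsConjTriple f g h a b) (H' : IsConjTriple f' g' h' a' b') :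
    IsConjTriple (f - f') (g - g') (h - h') (a - a') (b - b') where
  diff_f := H.diff_f.sub H'.diff_f
  diff_g := H.diff_g.sub H'.diff_g
  diff_h := H.diff_h.sub H'.diff_h
  S_f w hw := by simp only [Pi.sub_apply, H.S_f w hw, H'.S_f w hw, mul_sub]
  S_g w hw := by simp only [Pi.sub_apply, H.S_g w hw, H'.S_g w hw, mul_sub]
  S_h w hw := by simp only [Pi.sub_apply, H.S_h w hw, H'.S_h w hw, mul_sub]
  T_f w hw := by simp only [Pi.sub_apply, H.T_f w hw, H'.T_f w hw]
  T_g w hw := by simp only [Pi.sub_apply, H.T_g w hw, H'.T_g w hw]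
  T_h w hw := by simp only [Pi.sub_apply, H.T_h w hw, H'.T_h w hw]
  lim_f := H.lim_f.sub H'.lim_f
  lim_g := H.lim_g.sub H'.lim_g
  lim_h := H.lim_h.sub H'.lim_h

theorem add_add_eq_zero (H : IsConjTriple f g h a b) (τ : ℍ) : f τ + g τ + h τ = 0 :=
  eq_zero_of_levelOne_weight_two (f := fun w ↦ f w + g w + h w)
    ((H.diff_f.add H.diff_g).add H.diff_h)
    (fun w hw ↦ by rw [H.S_f w hw, H.S_g w hw, H.S_h w hw]; ring)
    (fun w hw ↦ by rw [H.T_f w hw, H.T_g w hw, H.T_h w hw]; ring)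
    ((H.lim_f.add H.lim_g).add H.lim_h) τ

theorem sum_mul_eq (H : IsConjTriple f g h a b) (τ : ℍ) :
    f τ * g τ + g τ * h τ + h τ * f τ = (a * b + b * b + b * a) * ModularForm.E₄ τ :=
  eq_mul_E_of_levelOne (by norm_num) (by norm_num) (by decide)
    (f := fun w ↦ f w * g w + g w * h w + h w * f w)
    (((H.diff_f.mul H.diff_g).add (H.diff_g.mul H.diff_h)).add (H.diff_h.mul H.diff_f))
    (fun w hw ↦ by rw [H.S_f w hw, H.S_g w hw, H.S_h w hw]; ring)
    (fun w hw ↦ by rw [H.T_f w hw, H.T_g w hw, H.T_h w hw]; ring)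
    (((H.lim_f.mul H.lim_g).add (H.lim_g.mul H.lim_h)).add (H.lim_h.mul H.lim_f)) τ

theorem mul_mul_eq (H : IsConjTriple f g h a b) (τ : ℍ) :
    f τ * g τ * h τ = (a * b * b) * ModularForm.E₆ τ :=
  eq_mul_E_of_levelOne (by norm_num) (by norm_num) (by decide)
    (f := fun w ↦ f w * g w * h w)
    ((H.diff_f.mul H.diff_g).mul H.diff_h)
    (fun w hw ↦ by rw [H.S_f w hw, H.S_g w hw, H.S_h w hw]; ring)
    (fun w hw ↦ by rw [H.T_f w hw, H.T_g w hw, H.T_h w hw]; ring)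
    ((H.lim_f.mul H.lim_g).mul H.lim_h) τ

/-- Two conjugate triples with the same limits agree: the differences are the roots of a cubic
polynomial whose lower coefficients are level one forms vanishing at `i∞`, hence zero. -/
theorem fst_eq (H : IsConjTriple f g h a b) (H' : IsConjTriple f' g' h' a b) (τ : ℍ) :
    f τ = f' τ := by
  have K := H.sub H'
  rw [sub_self, sub_self] at K
  have h₁ := K.add_add_eq_zero τ
  have h₂ := K.sum_mul_eq τ
  have h₃ := K.mul_mul_eq τ
  simp only [mul_zero, add_zero, zero_mul] at h₂ h₃
  rw [← sub_eq_zero, ← Pi.sub_apply]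
  refine pow_eq_zero_iff (n := 3) (by norm_num) |>.1 ?_
  linear_combination (f - f') τ ^ 2 * h₁ - (f - f') τ * h₂ + h₃

end IsConjTriple
end LevelOne

/-! ### Conjugate triples of weight two: Eisenstein series and theta constants -/

section Triples
open Filter Topology

lemma im_neg_one_div_pos {w : ℂ} (hw : 0 < w.im) : 0 < (-1 / w).im := by
  simpa [neg_div] using UpperHalfPlane.im_inv_neg_coe_pos ⟨w, hw⟩

lemma ne_zero_of_im_pos {w : ℂ} (hw : 0 < w.im) : w ≠ 0 := by
  rintro rfl
  simp at hw

lemma eventually_im_pos : ∀ᶠ w : ℂ in comap Complex.im atTop, 0 < w.im :=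
  tendsto_comap.eventually (eventually_gt_atTop 0)

lemma tendsto_comap_im_mul_add {r : ℝ} (hr : 0 < r) (s : ℝ) :
    Tendsto (fun w : ℂ ↦ r * w + s) (comap Complex.im atTop) (comap Complex.im atTop) := by
  rw [tendsto_comap_iff]
  refine (tendsto_comap.const_mul_atTop hr).congr fun w ↦ ?_
  simp

/-- The quasimodular Eisenstein series `E₂` as a function on `ℂ`, given by the logarithmic
derivative of `η`; only its values on the upper half-plane are meaningful. -/
def eisTwo (w : ℂ) : ℂ := 12 / (π * I) * logDeriv ModularForm.eta w

lemma eisTwo_coe (τ : ℍ) : eisTwo τ = EisensteinSeries.E2 τ := by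
  rw [eisTwo, ModularForm.logDeriv_eta_eq_E2]
  field_simp

lemma differentiableOn_eta : DifferentiableOn ℂ ModularForm.eta upperHalfPlaneSet := fun _ hz ↦
  (ModularForm.differentiableAt_eta_of_mem_upperHalfPlaneSet hz).differentiableWithinAt

lemma differentiableOn_eisTwo : DifferentiableOn ℂ eisTwo upperHalfPlaneSet :=
  ((differentiableOn_eta.deriv isOpen_upperHalfPlaneSet).div differentiableOn_eta
    fun _ hz ↦ ModularForm.eta_ne_zero hz).const_mul _

lemma eisTwo_add_one {w : ℂ} (hw : 0 < w.im) : eisTwo (w + 1) = eisTwo w := by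
  have h := congrFun (EisensteinSeries.E2_slash_action ModularGroup.T) ⟨w, hw⟩
  have hden : denom (ModularGroup.T : GL (Fin 2) ℝ) w = 1 := by
    rw [← UpperHalfPlane.coe_mk w hw, ModularGroup.denom_apply]
    simp [ModularGroup.T]
  rw [ModularForm.SL_slash_apply, UpperHalfPlane.modular_T_smul, EisensteinSeries.D2_T,
    UpperHalfPlane.coe_mk, hden] at h
  simp only [one_zpow, mul_one, smul_zero, sub_zero, ← eisTwo_coe] at h
  simpa [add_comm] using h

lemma eisTwo_neg_one_div {w : ℂ} (hw : 0 < w.im) :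
    eisTwo (-1 / w) = w ^ 2 * eisTwo w + 6 * w / (π * I) := by
  have h0 := ne_zero_of_im_pos hw
  have h := congrFun (EisensteinSeries.E2_slash_action ModularGroup.S) ⟨w, hw⟩
  rw [ModularForm.SL_slash_apply, UpperHalfPlane.modular_S_smul, ModularGroup.denom_S,
    Pi.sub_apply, Pi.smul_apply, EisensteinSeries.D2_S, riemannZeta_two,
    ← eisTwo_coe, ← eisTwo_coe] at h
  simp only [zpow_neg, smul_eq_mul] at h
  rw [show (-w)⁻¹ = -1 / w by rw [neg_div, one_div, inv_neg]] at h
  have hpi : (π : ℂ) ≠ 0 := by exact_mod_cast Real.pi_ne_zero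
  rw [zpow_ofNat] at h
  field_simp at h
  field_simp
  rw [h]
  linear_combination -6 * w * I_sq

lemma tendsto_eisTwo : Tendsto eisTwo (comap Complex.im atTop) (𝓝 1) := by
  have key : Tendsto EisensteinSeries.E2 atImInfty (𝓝 1) := by
    -- On `im τ ≥ 1` the series is dominated by its value at `τ = i`.
    have hsum : Summable fun n : ℕ ↦
        ‖(ArithmeticFunction.sigma 1 (n + 1) : ℂ) *
          cexp (2 * π * I * (UpperHalfPlane.I : ℍ)) ^ (n + 1)‖ :=
      ((summable_nat_add_iff 1).2
        (EisensteinSeries.summable_sigma_mul_cexp_pow (k := 2) one_le_two UpperHalfPlane.I)).norm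
    have hq : Tendsto (fun τ : ℍ ↦ cexp (2 * π * I * τ)) atImInfty (𝓝 0) := by
      simpa [Function.Periodic.qParam] using qParam_tendsto_atImInfty one_pos
    have h := tendsto_tsum_of_dominated_convergence (𝓕 := atImInfty) (g := fun _ ↦ (0 : ℂ))
      (f := fun (τ : ℍ) (n : ℕ) ↦
        (ArithmeticFunction.sigma 1 (n + 1) : ℂ) * cexp (2 * π * I * τ) ^ (n + 1)) hsum
      (fun n ↦ by simpa using (hq.pow (n + 1)).const_mul (ArithmeticFunction.sigma 1 (n + 1) : ℂ))
      (by
        filter_upwards [tendsto_comap.eventually (eventually_ge_atTop 1)] with τ hτ n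
        rw [norm_mul, norm_mul, norm_pow, norm_pow]
        gcongr 2
        rw [Complex.norm_exp, Complex.norm_exp]
        simpa using mul_le_mul_of_nonneg_left hτ Real.two_pi_pos.le)
    rw [tsum_zero] at h
    have h2 := (h.const_mul 24).const_sub 1
    simp only [mul_zero, sub_zero] at h2
    refine h2.congr fun τ ↦ ?_
    rw [EisensteinSeries.E2_eq_tsum_cexp,
      tsum_pnat_eq_tsum_succ
        (f := fun n ↦ (ArithmeticFunction.sigma 1 n : ℂ) * cexp (2 * π * I * τ) ^ n)]
  refine (key.comp tendsto_comap_im_ofComplex).congr' ?_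
  filter_upwards [eventually_im_pos] with w hw
  simp [← eisTwo_coe, ofComplex_apply_of_im_pos hw]

lemma E2level_two_eq (τ : ℍ) : E2level 2 τ = 2 * eisTwo (2 * τ) - eisTwo τ := by
  have h2 : (2 * (τ : ℂ)) ∈ upperHalfPlaneSet := by simpa using τ.im_pos
  have hd := ModularForm.differentiableAt_eta_of_mem_upperHalfPlaneSet h2
  have hc : logDeriv (fun w : ℂ ↦ ModularForm.eta (2 * w)) τ =
      2 * logDeriv ModularForm.eta (2 * τ) := by
    have := logDeriv_comp (f := ModularForm.eta) (g := fun w : ℂ ↦ 2 * w)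
      (x := (τ : ℂ)) hd (by fun_prop)
    rw [Function.comp_def] at this
    rw [this, deriv_const_mul_id, mul_comm]
  have hdiv : logDeriv (fun w : ℂ ↦ ModularForm.eta w / ModularForm.eta (2 * w)) τ =
      logDeriv ModularForm.eta τ - logDeriv (fun w : ℂ ↦ ModularForm.eta (2 * w)) τ :=
    logDeriv_div (f := ModularForm.eta) (g := fun w : ℂ ↦ ModularForm.eta (2 * w)) (τ : ℂ)
      (ModularForm.eta_ne_zero τ.im_pos) (ModularForm.eta_ne_zero h2)
      (ModularForm.differentiableAt_eta_of_mem_upperHalfPlaneSet τ.im_pos)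
      (hd.comp (τ : ℂ) (by fun_prop))
  rw [E2level, Nat.cast_ofNat, hdiv, hc, eisTwo, eisTwo]
  field_simp
  ring

/-- The transformation of `E₂` under the matrix `(1, -1; 2, -1)`. -/
lemma eisTwo_sub_one_div_two_mul_sub_one {w : ℂ} (hw : 0 < w.im) :
    eisTwo ((w - 1) / (2 * w - 1)) = (2 * w - 1) ^ 2 * eisTwo w + 12 * (2 * w - 1) / (π * I) := by
  have h1 : 0 < (w - 1).im := by simpa using hw
  have h2 := im_neg_one_div_pos h1
  have h3 : 0 < (-1 / (w - 1) - 2).im := by simpa using h2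
  have e1 : eisTwo (w - 1) = eisTwo w := by simpa using (eisTwo_add_one h1).symm
  have e3 : eisTwo (-1 / (w - 1) - 2) = eisTwo (-1 / (w - 1)) := by
    have h4 : 0 < (-1 / (w - 1) - 2 + 1).im := by simpa using h2
    rw [← eisTwo_add_one h3, ← eisTwo_add_one h4]
    ring_nf
  have n1 := ne_zero_of_im_pos h1
  have n2 : 2 * w - 1 ≠ 0 := ne_zero_of_im_pos (by simpa using hw)
  -- The matrix is `S T⁻² S T⁻¹`.
  have e : (w - 1) / (2 * w - 1) = -1 / (-1 / (w - 1) - 2) := by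
    have : -1 / (w - 1) - 2 = -(2 * w - 1) / (w - 1) := by field_simp; ring
    rw [this]
    field_simp
  rw [e, eisTwo_neg_one_div h3, e3, eisTwo_neg_one_div h1, e1]
  field_simp
  ring

/-- The conjugates of `E₂^{(2)}(w) = 2 E₂(2w) - E₂(w)`. -/
lemma isConjTriple_eisTwo :
    IsConjTriple (fun w ↦ 2 * eisTwo (2 * w) - eisTwo w) (fun w ↦ eisTwo (w / 2) / 2 - eisTwo w)
      (fun w ↦ eisTwo ((w + 1) / 2) / 2 - eisTwo w) 1 (-1 / 2) where
  diff_f := ((differentiableOn_eisTwo.comp (by fun_prop) fun w hw ↦ by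
    simpa using hw).const_mul 2).sub differentiableOn_eisTwo
  diff_g := ((differentiableOn_eisTwo.comp (by fun_prop) fun w hw ↦ by
    simpa using hw).div_const 2).sub differentiableOn_eisTwo
  diff_h := ((differentiableOn_eisTwo.comp (by fun_prop) fun w hw ↦ by
    simpa using hw).div_const 2).sub differentiableOn_eisTwo
  S_f w hw := by
    have h0 := ne_zero_of_im_pos hw
    have h2 : 0 < (w / 2).im := by simpa using hw
    rw [eisTwo_neg_one_div hw, show 2 * (-1 / w) = -1 / (w / 2) by field_simp,
      eisTwo_neg_one_div h2]
    ring
  S_g w hw := by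
    have h0 := ne_zero_of_im_pos hw
    have h2 : 0 < (2 * w).im := by simpa using hw
    rw [eisTwo_neg_one_div hw, show -1 / w / 2 = -1 / (2 * w) by field_simp,
      eisTwo_neg_one_div h2]
    ring
  S_h w hw := by
    have h0 := ne_zero_of_im_pos hw
    have h2 : 0 < ((w + 1) / 2).im := by simpa using hw
    have e : (-1 / w + 1) / 2 = ((w + 1) / 2 - 1) / (2 * ((w + 1) / 2) - 1) := by
      rw [show 2 * ((w + 1) / 2) - 1 = w by ring]
      field_simp
      ring
    rw [eisTwo_neg_one_div hw, e, eisTwo_sub_one_div_two_mul_sub_one h2]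
    ring
  T_f w hw := by
    have h2 : 0 < (2 * w).im := by simpa using hw
    have h2' : 0 < (2 * w + 1).im := by simpa using hw
    rw [eisTwo_add_one hw, ← eisTwo_add_one h2, ← eisTwo_add_one h2']
    ring_nf
  T_g w hw := by rw [eisTwo_add_one hw]
  T_h w hw := by
    have h2 : 0 < (w / 2).im := by simpa using hw
    rw [eisTwo_add_one hw, show (w + 1 + 1) / 2 = w / 2 + 1 by ring, eisTwo_add_one h2]
  lim_f := by
    have h := tendsto_eisTwo.comp (tendsto_comap_im_mul_add (r := 2) (by norm_num) 0)
    convert! (h.const_mul 2).sub tendsto_eisTwo using 2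
    · simp
    · norm_num
  lim_g := by
    have h := tendsto_eisTwo.comp (tendsto_comap_im_mul_add (r := 1 / 2) (by norm_num) 0)
    convert! (h.div_const 2).sub tendsto_eisTwo using 2
    · simp [div_eq_inv_mul]
    · norm_num
  lim_h := by
    have h := tendsto_eisTwo.comp (tendsto_comap_im_mul_add (r := 1 / 2) (by norm_num) (1 / 2))
    convert! (h.div_const 2).sub tendsto_eisTwo using 2
    · simp; ring_nf
    · norm_num

lemma jacobiTheta₂_tau_add_one (z τ : ℂ) : jacobiTheta₂ z (τ + 1) = jacobiTheta₂ (z + 1 / 2) τ := by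
  refine tsum_congr fun n ↦ ?_
  have h : cexp (π * I * n ^ 2) = cexp (π * I * n) := by
    have h1 := exp_pi_mul_I_mul_int (n ^ 2)
    push_cast at h1
    rw [h1, exp_pi_mul_I_mul_int]
    rcases Int.even_or_odd n with hn | hn
    · rw [hn.neg_one_zpow, (hn.pow_of_ne_zero two_ne_zero).neg_one_zpow]
    · rw [hn.neg_one_zpow, hn.pow.neg_one_zpow]
  rw [jacobiTheta₂_term, jacobiTheta₂_term,
    show 2 * π * I * n * z + π * I * n ^ 2 * (τ + 1) =
      2 * π * I * n * z + π * I * n ^ 2 * τ + π * I * n ^ 2 by ring,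
    Complex.exp_add, h, ← Complex.exp_add]
  ring_nf

lemma jacobiTheta₂_half_add_half (w : ℂ) : jacobiTheta₂ (1 / 2 + 1 / 2) w = jacobiTheta₂ 0 w := by
  rw [show (1 / 2 + 1 / 2 : ℂ) = 0 + 1 by norm_num, jacobiTheta₂_add_left]

lemma thetaTwo_zero_add_one_pow_four (w : ℂ) : thetaTwo 0 (w + 1) ^ 4 = -thetaTwo 0 w ^ 4 := by
  rw [thetaTwo, thetaTwo, jacobiTheta₂_tau_add_one,
    show 0 + (w + 1) / 2 + 1 / 2 = 0 + w / 2 + 1 by ring, jacobiTheta₂_add_left, mul_pow, mul_pow,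
    ← Complex.exp_nat_mul, ← Complex.exp_nat_mul,
    show ((4 : ℕ) : ℂ) * (π * I * (w + 1) / 4 + π * I * 0) =
      (4 : ℕ) * (π * I * w / 4 + π * I * 0) + π * I by push_cast; ring,
    Complex.exp_add _ (π * I), Complex.exp_pi_mul_I]
  ring

lemma cpow_half_pow_four (w : ℂ) : ((-I * w) ^ (1 / 2 : ℂ)) ^ 4 = -w ^ 2 := by
  have h : ((-I * w) ^ (1 / 2 : ℂ)) ^ 2 = -I * w := by
    simp
  rw [show (4 : ℕ) = 2 * 2 from rfl, pow_mul, h]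
  linear_combination w ^ 2 * I_sq

lemma jacobiTheta₂_zero_neg_one_div_pow_four {w : ℂ} (hw : 0 < w.im) :
    jacobiTheta₂ 0 (-1 / w) ^ 4 = -w ^ 2 * jacobiTheta₂ 0 w ^ 4 := by
  have h0 := ne_zero_of_im_pos hw
  have h := congrArg (· ^ 4) (jacobiTheta₂_functional_equation 0 w)
  simp only [mul_pow, div_pow, cpow_half_pow_four] at h
  simp only [ne_eq, OfNat.ofNat_ne_zero, not_false_eq_true, zero_pow, mul_zero, zero_div,
    Complex.exp_zero, one_pow, mul_one] at h
  rw [h]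
  field_simp

lemma thetaTwo_zero_neg_one_div_pow_four {w : ℂ} (hw : 0 < w.im) :
    thetaTwo 0 (-1 / w) ^ 4 = -w ^ 2 * jacobiTheta₂ (1 / 2) w ^ 4 := by
  have h0 := ne_zero_of_im_pos hw
  have e : thetaTwo 0 (-1 / w) =
      cexp (-π * I * (1 / 2) ^ 2 / w) * jacobiTheta₂ (1 / 2 / w) (-1 / w) := by
    rw [thetaTwo, ← jacobiTheta₂_neg_left]
    ring_nf
  have h := congrArg (· ^ 4) (jacobiTheta₂_functional_equation (1 / 2) w)
  rw [mul_assoc, ← e] at h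
  simp only [mul_pow, div_pow, cpow_half_pow_four] at h
  rw [h]
  field_simp

lemma jacobiTheta₂_half_neg_one_div_pow_four {w : ℂ} (hw : 0 < w.im) :
    jacobiTheta₂ (1 / 2) (-1 / w) ^ 4 = -w ^ 2 * thetaTwo 0 w ^ 4 := by
  have h0 := ne_zero_of_im_pos hw
  have h := thetaTwo_zero_neg_one_div_pow_four (im_neg_one_div_pos hw)
  rw [show -1 / (-1 / w) = w by field_simp] at h
  rw [h]
  field_simp

lemma jacobiTheta₂_zero_sq {τ : ℂ} (hτ : 0 < τ.im) :
    jacobiTheta₂ 0 τ ^ 2 = jacobiTheta₂ 0 (2 * τ) ^ 2 + thetaTwo 0 (2 * τ) ^ 2 := by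
  simpa [← pow_two] using jacobiTheta₂_mul_jacobiTheta₂ 0 0 hτ

lemma jacobiTheta₂_half_sq {τ : ℂ} (hτ : 0 < τ.im) :
    jacobiTheta₂ (1 / 2) τ ^ 2 = jacobiTheta₂ 0 (2 * τ) ^ 2 - thetaTwo 0 (2 * τ) ^ 2 := by
  have h := jacobiTheta₂_mul_jacobiTheta₂ (1 / 2) (1 / 2) hτ
  have h' := thetaTwo_add_one 0 (2 * τ)
  rw [jacobiTheta₂_half_add_half, show (1 / 2 + 1 / 2 : ℂ) = 0 + 1 by norm_num, h', sub_self] at h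
  linear_combination h

lemma thetaTwo_zero_sq {τ : ℂ} (hτ : 0 < τ.im) :
    thetaTwo 0 τ ^ 2 = 2 * thetaTwo 0 (2 * τ) * jacobiTheta₂ 0 (2 * τ) := by
  have h := thetaTwo_mul_thetaTwo 0 0 hτ
  simp only [add_zero, sub_zero] at h
  linear_combination h

/-- Jacobi's identity `θ₃⁴ = θ₂⁴ + θ₄⁴` between theta constants. -/
theorem jacobiTheta₂_zero_pow_four {τ : ℂ} (hτ : 0 < τ.im) :
    jacobiTheta₂ 0 τ ^ 4 = thetaTwo 0 τ ^ 4 + jacobiTheta₂ (1 / 2) τ ^ 4 := by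
  rw [show 4 = 2 * 2 from rfl, pow_mul, pow_mul, pow_mul, jacobiTheta₂_zero_sq hτ,
    jacobiTheta₂_half_sq hτ, thetaTwo_zero_sq hτ]
  ring

lemma tendsto_jacobiTheta₂_zero : Tendsto (jacobiTheta₂ 0) (comap Complex.im atTop) (𝓝 1) := by
  have h : Tendsto (fun τ : ℂ ↦ Real.exp (-π * τ.im)) (comap Complex.im atTop) (𝓝 0) :=
    Real.tendsto_exp_atBot.comp (tendsto_comap.const_mul_atTop_of_neg (by simp [Real.pi_pos]))
  simpa [jacobiTheta_eq_jacobiTheta₂] using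
    (isBigO_at_im_infty_jacobiTheta_sub_one.trans_tendsto h).add_const 1

lemma tendsto_jacobiTheta₂_half :
    Tendsto (jacobiTheta₂ (1 / 2)) (comap Complex.im atTop) (𝓝 1) := by
  refine (tendsto_jacobiTheta₂_zero.comp (tendsto_comap_im_mul_add one_pos 1)).congr fun w ↦ ?_
  simp [jacobiTheta₂_tau_add_one]

lemma tendsto_thetaTwo_zero_pow_four :
    Tendsto (fun w ↦ thetaTwo 0 w ^ 4) (comap Complex.im atTop) (𝓝 0) := by
  have h := (tendsto_jacobiTheta₂_zero.pow 4).sub (tendsto_jacobiTheta₂_half.pow 4)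
  rw [sub_self] at h
  refine h.congr' ?_
  filter_upwards [eventually_im_pos] with w hw
  rw [jacobiTheta₂_zero_pow_four hw]
  ring

lemma differentiableOn_jacobiTheta₂ (z : ℂ) :
    DifferentiableOn ℂ (jacobiTheta₂ z) upperHalfPlaneSet := fun _ hw ↦
  (differentiableAt_jacobiTheta₂_snd z hw).differentiableWithinAt

lemma differentiableOn_thetaTwo_zero : DifferentiableOn ℂ (thetaTwo 0) upperHalfPlaneSet := by
  intro w hw
  have h : DifferentiableAt ℂ (fun w : ℂ ↦ jacobiTheta₂ (0 + w / 2) w) w :=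
    (hasFDerivAt_jacobiTheta₂ (0 + w / 2) hw).differentiableAt.comp w
      (f := fun w : ℂ ↦ (0 + w / 2, w)) (by fun_prop)
  exact (DifferentiableAt.mul (by fun_prop) h).differentiableWithinAt

/-- The conjugates of `(θ₃⁴ + θ₄⁴) / 2`. -/
lemma isConjTriple_theta :
    IsConjTriple (fun w ↦ (jacobiTheta₂ 0 w ^ 4 + jacobiTheta₂ (1 / 2) w ^ 4) / 2)
      (fun w ↦ -(jacobiTheta₂ 0 w ^ 4 + thetaTwo 0 w ^ 4) / 2)
      (fun w ↦ (thetaTwo 0 w ^ 4 - jacobiTheta₂ (1 / 2) w ^ 4) / 2) 1 (-1 / 2) where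
  diff_f := (((differentiableOn_jacobiTheta₂ 0).pow 4).add
    ((differentiableOn_jacobiTheta₂ (1 / 2)).pow 4)).div_const 2
  diff_g := ((((differentiableOn_jacobiTheta₂ 0).pow 4).add
    (differentiableOn_thetaTwo_zero.pow 4)).neg).div_const 2
  diff_h := ((differentiableOn_thetaTwo_zero.pow 4).sub
    ((differentiableOn_jacobiTheta₂ (1 / 2)).pow 4)).div_const 2
  S_f w hw := by
    rw [jacobiTheta₂_zero_neg_one_div_pow_four hw, jacobiTheta₂_half_neg_one_div_pow_four hw]
    ring
  S_g w hw := by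
    rw [jacobiTheta₂_zero_neg_one_div_pow_four hw, thetaTwo_zero_neg_one_div_pow_four hw]
    ring
  S_h w hw := by
    rw [jacobiTheta₂_half_neg_one_div_pow_four hw, thetaTwo_zero_neg_one_div_pow_four hw]
    ring
  T_f w hw := by
    rw [jacobiTheta₂_tau_add_one, jacobiTheta₂_tau_add_one, jacobiTheta₂_half_add_half, zero_add,
      add_comm]
  T_g w hw := by
    rw [jacobiTheta₂_tau_add_one, thetaTwo_zero_add_one_pow_four, zero_add]
    ring
  T_h w hw := by
    rw [jacobiTheta₂_tau_add_one, thetaTwo_zero_add_one_pow_four, jacobiTheta₂_half_add_half]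
    ring
  lim_f := by
    convert! ((tendsto_jacobiTheta₂_zero.pow 4).add (tendsto_jacobiTheta₂_half.pow 4)).div_const 2
      using 2
    norm_num
  lim_g := by
    convert! ((tendsto_jacobiTheta₂_zero.pow 4).add tendsto_thetaTwo_zero_pow_four).neg.div_const 2
      using 2
    norm_num
  lim_h := by
    convert! (tendsto_thetaTwo_zero_pow_four.sub (tendsto_jacobiTheta₂_half.pow 4)).div_const 2
      using 2
    norm_num

theorem E2level_two_eq_theta (τ : ℍ) :
    E2level 2 τ = (jacobiTheta₂ 0 τ ^ 4 + jacobiTheta₂ (1 / 2) τ ^ 4) / 2 := by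
  rw [E2level_two_eq]
  exact isConjTriple_eisTwo.fst_eq isConjTriple_theta τ

/-- `E₄` is a multiple of the second symmetric function of the theta triple. -/
theorem E₄_eq_theta (τ : ℍ) :
    ModularForm.E₄ τ =
      (thetaTwo 0 τ ^ 8 + jacobiTheta₂ 0 τ ^ 8 + jacobiTheta₂ (1 / 2) τ ^ 8) / 2 := by
  have h := isConjTriple_theta.sum_mul_eq τ
  have hJ := jacobiTheta₂_zero_pow_four τ.im_pos
  linear_combination 4 / 3 * h -
    1 / 6 * (jacobiTheta₂ 0 τ ^ 4 - thetaTwo 0 τ ^ 4 - jacobiTheta₂ (1 / 2) τ ^ 4) * hJ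

/-- `E₆` is a multiple of the third symmetric function of the theta triple. -/
theorem E₆_eq_theta (τ : ℍ) :
    ModularForm.E₆ τ =
      (jacobiTheta₂ 0 τ ^ 4 + jacobiTheta₂ (1 / 2) τ ^ 4) *
        (jacobiTheta₂ 0 τ ^ 4 + thetaTwo 0 τ ^ 4) *
        (jacobiTheta₂ (1 / 2) τ ^ 4 - thetaTwo 0 τ ^ 4) / 2 := by
  have h := isConjTriple_theta.mul_mul_eq τ
  linear_combination -4 * h

theorem eta_pow_eq_theta (τ : ℍ) :
    256 * ModularForm.eta τ ^ 24 =
      (thetaTwo 0 τ * jacobiTheta₂ 0 τ * jacobiTheta₂ (1 / 2) τ) ^ 8 := by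
  have h := ModularForm.discriminant_eq_E₄_cube_sub_E₆_sq τ
  have hJ := jacobiTheta₂_zero_pow_four τ.im_pos
  rw [ModularForm.discriminant, E₄_eq_theta, E₆_eq_theta] at h
  rw [h, mul_pow, mul_pow, show 8 = 4 * 2 from rfl, pow_mul, pow_mul, pow_mul, hJ]
  ring

end Triples

/-! ### The eta function and theta constants -/

section EtaTheta
open Filter Topology

lemma tendsto_tprod_one_sub_eta_q :
    Tendsto (fun w : ℂ ↦ ∏' n : ℕ, (1 - ModularForm.eta_q n w)) (comap Complex.im atTop) (𝓝 1) := by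
  have h0 : (0 : ℂ) ∈ Metric.ball (0 : ℂ) 1 := Metric.mem_ball_self one_pos
  have h := (ModularForm.differentiableOn_tprod_one_sub_pow.differentiableAt
    (Metric.isOpen_ball.mem_nhds h0)).continuousAt.tendsto
  simp only [ne_eq, Nat.add_eq_zero_iff, one_ne_zero, and_false, not_false_eq_true, zero_pow,
    sub_zero, tprod_one] at h
  exact h.comp ((Function.Periodic.qParam_tendsto one_pos).mono_right nhdsWithin_le_nhds)

/-- The powers of `q` cancel in `η(2w) / η(w)²`, which leaves a quotient of Euler products. -/
lemma tendsto_eta_two_mul_div_eta_sq :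
    Tendsto (fun w ↦ ModularForm.eta (2 * w) / ModularForm.eta w ^ 2) (comap Complex.im atTop)
      (𝓝 1) := by
  have h := (tendsto_tprod_one_sub_eta_q.comp (tendsto_comap_im_mul_add two_pos 0)).div
    (tendsto_tprod_one_sub_eta_q.pow 2) (by norm_num)
  rw [one_pow, div_one] at h
  refine h.congr fun w ↦ ?_
  have hq : Function.Periodic.qParam 24 (2 * w) = Function.Periodic.qParam 24 w ^ 2 := by
    rw [Function.Periodic.qParam, Function.Periodic.qParam, ← Complex.exp_nat_mul]
    push_cast
    ring_nf
  have hne := Function.Periodic.qParam_ne_zero (h := 24) w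
  simp only [ModularForm.eta, hq, mul_pow, Pi.div_apply, Function.comp_apply]
  rw [mul_div_mul_left _ _ (pow_ne_zero 2 hne)]
  simp

/-- The identity `θ₂ θ₃ θ₄ = 2 η³` between theta constants and `η`, squared. -/
theorem theta_mul_sq_eq_eta_pow {τ : ℂ} (hτ : 0 < τ.im) :
    (thetaTwo 0 τ * jacobiTheta₂ 0 τ * jacobiTheta₂ (1 / 2) τ) ^ 2 =
      4 * ModularForm.eta τ ^ 6 := by
  set f : ℂ → ℂ := fun w ↦ (thetaTwo 0 w * jacobiTheta₂ 0 w * jacobiTheta₂ (1 / 2) w) ^ 2 with hf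
  set r : ℂ → ℂ := fun w ↦ f w / ModularForm.eta w ^ 6 with hr
  have hη : ∀ w : ℂ, 0 < w.im → ModularForm.eta w ≠ 0 := fun w hw ↦ ModularForm.eta_ne_zero hw
  have hcont : ContinuousOn r upperHalfPlaneSet :=
    (DifferentiableOn.div (((differentiableOn_thetaTwo_zero.mul
      (differentiableOn_jacobiTheta₂ 0)).mul (differentiableOn_jacobiTheta₂ (1 / 2))).pow 2)
      (differentiableOn_eta.pow 6) fun w hw ↦ pow_ne_zero 6 (hη w hw)).continuousOn
  have hr4 : ∀ w : ℂ, 0 < w.im → r w ^ 4 = 256 := fun w hw ↦ by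
    have h := eta_pow_eq_theta ⟨w, hw⟩
    rw [UpperHalfPlane.coe_mk] at h
    rw [hr, hf, div_pow, ← pow_mul, ← pow_mul, ← h, mul_div_assoc,
      div_self (pow_ne_zero _ (hη w hw)), mul_one]
  -- `r` is continuous with values in the fourth roots of 256.
  obtain ⟨c, hconst⟩ : ∃ c, ∀ w : ℂ, 0 < w.im → r w = c := ⟨r τ, fun w hw ↦
    (Convex.isPreconnected (convex_halfSpace_im_gt 0)).constant_of_mapsTo
      (Polynomial.nthRoots 4 (256 : ℂ)).toFinset.finite_toSet.isDiscrete hcont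
      (fun v hv ↦ by simpa [Polynomial.mem_nthRoots] using hr4 v hv) hw hτ⟩
  have hc : c ≠ 0 := fun h ↦ by simpa [hconst τ hτ, h] using hr4 τ hτ
  -- Comparing `r w` with `r (2 * w)` through the duplication formulas expresses `c` by
  -- functions with a known limit at `i∞`.
  have key : ∀ w : ℂ, 0 < w.im →
      4 * jacobiTheta₂ (1 / 2) (2 * w) ^ 6 * (ModularForm.eta (2 * w) / ModularForm.eta w ^ 2) ^ 6 =
        c := fun w hw ↦ by
    have h2 : 0 < (2 * w).im := by simpa using hw
    have e1 : f w = c * ModularForm.eta w ^ 6 := by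
      rw [← hconst w hw, hr, div_mul_cancel₀ _ (pow_ne_zero 6 (hη w hw))]
    have e2 : f (2 * w) = c * ModularForm.eta (2 * w) ^ 6 := by
      rw [← hconst _ h2, hr, div_mul_cancel₀ _ (pow_ne_zero 6 (hη _ h2))]
    have e3 : f w ^ 2 = 4 * f (2 * w) * jacobiTheta₂ (1 / 2) (2 * w) ^ 6 := by
      have hJ := jacobiTheta₂_zero_pow_four h2
      have hJ' : jacobiTheta₂ (1 / 2) (2 * w) ^ 8 =
          (jacobiTheta₂ 0 (2 * w) ^ 4 - thetaTwo 0 (2 * w) ^ 4) ^ 2 := by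
        rw [hJ]
        ring
      simp only [hf, mul_pow]
      rw [thetaTwo_zero_sq hw, jacobiTheta₂_zero_sq hw, jacobiTheta₂_half_sq hw]
      linear_combination (-4) * (thetaTwo 0 (2 * w) * jacobiTheta₂ 0 (2 * w)) ^ 2 * hJ'
    rw [e1, e2] at e3
    have := hη w hw
    field_simp
    apply mul_left_cancel₀ hc
    linear_combination -e3
  have hlim : Tendsto (fun _ : ℂ ↦ c) (comap Complex.im atTop) (𝓝 4) := by
    have h := ((((tendsto_jacobiTheta₂_half.comp
      (tendsto_comap_im_mul_add two_pos 0)).pow 6).const_mul 4).mul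
      (tendsto_eta_two_mul_div_eta_sq.pow 6))
    simp only [one_pow, mul_one] at h
    refine h.congr' ?_
    filter_upwards [eventually_im_pos] with w hw
    simpa using key w hw
  have hne : (comap Complex.im atTop).NeBot :=
    comap_neBot_iff_frequently.2 (Eventually.frequently (.of_forall fun y ↦ ⟨y * I, by simp⟩))
  have h4 := tendsto_nhds_unique hlim tendsto_const_nhds
  rw [h4, ← hconst τ hτ, hr, div_mul_cancel₀ _ (pow_ne_zero 6 (hη τ hτ))]

lemma theta_constants_ne_zero {τ : ℂ} (hτ : 0 < τ.im) :
    thetaTwo 0 τ ≠ 0 ∧ jacobiTheta₂ 0 τ ≠ 0 ∧ jacobiTheta₂ (1 / 2) τ ≠ 0 := by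
  have h : (thetaTwo 0 τ * jacobiTheta₂ 0 τ * jacobiTheta₂ (1 / 2) τ) ^ 2 ≠ 0 := by
    rw [theta_mul_sq_eq_eta_pow hτ]
    exact mul_ne_zero (by norm_num) (pow_ne_zero 6 (ModularForm.eta_ne_zero hτ))
  simpa [mul_ne_zero_iff, and_assoc] using h

end EtaTheta

/-! ### Landen transformations and Jacobi identities -/

section Landen

variable (z : ℂ) {τ : ℂ}

lemma jacobiTheta₂_mul_zero (hτ : 0 < τ.im) : jacobiTheta₂ z τ * jacobiTheta₂ 0 τ =
    jacobiTheta₂ z (2 * τ) ^ 2 + thetaTwo z (2 * τ) ^ 2 := by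
  have h := jacobiTheta₂_mul_jacobiTheta₂ z 0 hτ
  simp only [add_zero, sub_zero] at h
  linear_combination h

lemma thetaTwo_mul_zero (hτ : 0 < τ.im) : thetaTwo z τ * thetaTwo 0 τ =
    2 * thetaTwo z (2 * τ) * jacobiTheta₂ z (2 * τ) := by
  have h := thetaTwo_mul_thetaTwo z 0 hτ
  simp only [add_zero, sub_zero] at h
  linear_combination h

lemma jacobiTheta₂_add_half_mul_half (hτ : 0 < τ.im) :
    jacobiTheta₂ (z + 1 / 2) τ * jacobiTheta₂ (1 / 2) τ =
      jacobiTheta₂ z (2 * τ) ^ 2 - thetaTwo z (2 * τ) ^ 2 := by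
  have h := jacobiTheta₂_mul_jacobiTheta₂ (z + 1 / 2) (1 / 2) hτ
  rw [show z + 1 / 2 + 1 / 2 = z + 1 by ring, add_sub_cancel_right, jacobiTheta₂_add_left,
    thetaTwo_add_one] at h
  linear_combination h

/-- Two linear relations between the squares of the four theta functions. Both sides are bilinear in
the values of `θ₂` and `θ₃` at `(2τ, 2z)` and at `(2τ, 0)`, by the addition formulas. -/
lemma jacobi_identities (hτ : 0 < τ.im) :
    jacobiTheta₂ (z + 1 / 2) τ ^ 2 * jacobiTheta₂ (1 / 2) τ ^ 2 =
        jacobiTheta₂ z τ ^ 2 * jacobiTheta₂ 0 τ ^ 2 - thetaTwo z τ ^ 2 * thetaTwo 0 τ ^ 2 ∧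
    thetaTwo (z + 1 / 2) τ ^ 2 * jacobiTheta₂ (1 / 2) τ ^ 2 =
        jacobiTheta₂ z τ ^ 2 * thetaTwo 0 τ ^ 2 - thetaTwo z τ ^ 2 * jacobiTheta₂ 0 τ ^ 2 := by
  have h3 := jacobiTheta₂_mul_jacobiTheta₂ z z hτ
  have h2 := thetaTwo_mul_thetaTwo z z hτ
  have h4 := jacobiTheta₂_mul_jacobiTheta₂ (z + 1 / 2) (z + 1 / 2) hτ
  have h1 := thetaTwo_mul_thetaTwo (z + 1 / 2) (z + 1 / 2) hτ
  rw [show z + 1 / 2 + (z + 1 / 2) = z + z + 1 by ring, jacobiTheta₂_add_left, thetaTwo_add_one,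
    sub_self, ← pow_two] at h4 h1
  rw [sub_self, ← pow_two] at h3 h2
  rw [h1, h2, h3, h4, jacobiTheta₂_zero_sq hτ, jacobiTheta₂_half_sq hτ, thetaTwo_zero_sq hτ]
  constructor <;> ring

end Landen

lemma coe_mulPt_two (τ : ℍ) : ((mulPt 2 τ : ℍ) : ℂ) = 2 * τ := by
  simp [mulPt]

end LevelTwo

end

open LevelTwo

theorem mainTheorem1 (τ : ℍ) :
    ModularForm.E₄ (LevelTwo.mulPt 2 τ) =
        5 / 4 * LevelTwo.E2level 2 τ ^ 2 - 1 / 4 * ModularForm.E₄ τ ∧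
    ModularForm.E₆ (LevelTwo.mulPt 2 τ) =
        7 / 8 * LevelTwo.E2level 2 τ ^ 3 + 1 / 8 * ModularForm.E₆ τ ∧
    (∀ z : ℂ, LevelTwo.A τ z =
        1 / 12 * LevelTwo.A (LevelTwo.mulPt 2 τ) z * LevelTwo.B (LevelTwo.mulPt 2 τ) z +
          1 / 12 * LevelTwo.E2level 2 τ * LevelTwo.A (LevelTwo.mulPt 2 τ) z ^ 2) ∧
    (∀ z : ℂ, LevelTwo.B τ z =
        1 / 12 * LevelTwo.B (LevelTwo.mulPt 2 τ) z *
            (LevelTwo.E2level 2 τ * LevelTwo.A (LevelTwo.mulPt 2 τ) z +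
              LevelTwo.B (LevelTwo.mulPt 2 τ) z) -
          1 / 16 * LevelTwo.A (LevelTwo.mulPt 2 τ) z ^ 2 *
            (LevelTwo.E2level 2 τ ^ 2 - ModularForm.E₄ τ)) := by
  have hτ : 0 < (τ : ℂ).im := τ.im_pos
  have hσ : 0 < (2 * (τ : ℂ)).im := by simpa using hτ
  obtain ⟨hT2, hT3, hT4⟩ := theta_constants_ne_zero hτ
  obtain ⟨ha, hb, hd⟩ := theta_constants_ne_zero hσ
  have t2 := thetaTwo_zero_sq hτ
  have t3 := jacobiTheta₂_zero_sq hτ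
  have t4 := jacobiTheta₂_half_sq hτ
  have hη := theta_mul_sq_eq_eta_pow hτ
  have hη' := theta_mul_sq_eq_eta_pow hσ
  have hJ := jacobiTheta₂_zero_pow_four hσ
  -- The theta constants `θ₂`, `θ₃`, `θ₄` at `2τ`.
  set a := thetaTwo 0 (2 * τ)
  set b := jacobiTheta₂ 0 (2 * τ)
  set d := jacobiTheta₂ (1 / 2) (2 * τ)
  have hE2 : E2level 2 τ = a ^ 4 + b ^ 4 := by
    rw [E2level_two_eq_theta]
    linear_combination 1 / 2 * (jacobiTheta₂ 0 τ ^ 2 + (b ^ 2 + a ^ 2)) * t3 +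
      1 / 2 * (jacobiTheta₂ (1 / 2) τ ^ 2 + (b ^ 2 - a ^ 2)) * t4
  have hd4 : d ^ 4 = b ^ 4 - a ^ 4 := by linear_combination -hJ
  have hE4 : ModularForm.E₄ τ = a ^ 8 + 14 * a ^ 4 * b ^ 4 + b ^ 8 := by
    rw [E₄_eq_theta, show 8 = 2 * 4 from rfl, pow_mul, pow_mul, pow_mul, t2, t3, t4]
    ring
  have hE6 : ModularForm.E₆ τ =
      (a ^ 4 + b ^ 4) * (a ^ 8 - 34 * a ^ 4 * b ^ 4 + b ^ 8) := by
    rw [E₆_eq_theta, show 4 = 2 * 2 from rfl, pow_mul, pow_mul, pow_mul, t2, t3, t4]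
    ring
  have hp : b ^ 2 + a ^ 2 ≠ 0 := t3 ▸ pow_ne_zero 2 hT3
  have hm : b ^ 2 - a ^ 2 ≠ 0 := t4 ▸ pow_ne_zero 2 hT4
  have hd4' : d ^ 4 = (b ^ 2 + a ^ 2) * (b ^ 2 - a ^ 2) := by rw [hd4]; ring
  -- All forms are now written as rational functions of `a ^ 2`, `b ^ 2` and the squares of
  -- `θ₂(2τ, z)` and `θ₃(2τ, z)`; `d` and the other two theta functions are eliminated by Jacobi's
  -- identities.
  have hA : ∀ z, A (mulPt 2 τ) z =
      4 * (jacobiTheta₂ z (2 * τ) ^ 2 * a ^ 2 - thetaTwo z (2 * τ) ^ 2 * b ^ 2) /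
      (a ^ 2 * b ^ 2 * ((b ^ 2 + a ^ 2) * (b ^ 2 - a ^ 2))) := fun z ↦ by
    have e : ModularForm.eta (2 * τ) ^ 6 = (a * b * d) ^ 2 / 4 := by rw [hη']; ring
    have hJ1 : thetaTwo (z + 1 / 2) (2 * τ) ^ 2 * d ^ 2 = _ := (jacobi_identities z hσ).2
    rw [A, theta1_eq, coe_mulPt_two, e, ← hd4', ← hJ1]
    generalize thetaTwo (z + 1 / 2) (2 * τ) = u
    field_simp
  have hB : ∀ z, B (mulPt 2 τ) z =
      4 * (thetaTwo z (2 * τ) ^ 2 / a ^ 2 + jacobiTheta₂ z (2 * τ) ^ 2 / b ^ 2 +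
      (jacobiTheta₂ z (2 * τ) ^ 2 * b ^ 2 - thetaTwo z (2 * τ) ^ 2 * a ^ 2) /
        ((b ^ 2 + a ^ 2) * (b ^ 2 - a ^ 2))) := fun z ↦ by
    have hJ4 : jacobiTheta₂ (z + 1 / 2) (2 * τ) ^ 2 * d ^ 2 = _ := (jacobi_identities z hσ).1
    rw [B, theta2_eq, theta2_eq, theta3_eq, theta3_eq, theta4_eq, theta4_eq, coe_mulPt_two,
      zero_add, ← hd4', ← hJ4]
    change 4 * (_ / a ^ 2 + _ / b ^ 2 + _ / d ^ 2) = _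
    generalize jacobiTheta₂ (z + 1 / 2) (2 * τ) = u
    field_simp
  refine ⟨?_, ?_, fun z ↦ ?_, fun z ↦ ?_⟩
  · rw [E₄_eq_theta, coe_mulPt_two, hE2, hE4, show 8 = 4 * 2 from rfl]
    simp only [pow_mul]
    rw [hd4]
    ring
  · rw [E₆_eq_theta, coe_mulPt_two, hE2, hE6, hd4]
    ring
  · have e : ModularForm.eta τ ^ 6 = a * b * ((b ^ 2 + a ^ 2) * (b ^ 2 - a ^ 2)) / 2 := by
      rw [mul_pow, mul_pow, t2, t3, t4] at hη
      linear_combination -1 / 4 * hη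
    have h1 : A τ z = 4 * (jacobiTheta₂ z (2 * τ) ^ 2 * a ^ 2 - thetaTwo z (2 * τ) ^ 2 * b ^ 2) *
        (jacobiTheta₂ z (2 * τ) ^ 2 * b ^ 2 - thetaTwo z (2 * τ) ^ 2 * a ^ 2) /
        (a ^ 2 * b ^ 2 * ((b ^ 2 + a ^ 2) * (b ^ 2 - a ^ 2)) ^ 2) := by
      have hL := congrArg (· ^ 2) (thetaTwo_mul_zero (z + 1 / 2) hτ)
      simp only [mul_pow, t2] at hL
      have hs : thetaTwo (z + 1 / 2) τ ^ 2 =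
          2 * (thetaTwo (z + 1 / 2) (2 * τ) ^ 2 * jacobiTheta₂ (z + 1 / 2) (2 * τ) ^ 2) /
            (a * b) := by
        rw [eq_div_iff (mul_ne_zero ha hb)]
        linear_combination 1 / 2 * hL
      have hJ1 : thetaTwo (z + 1 / 2) (2 * τ) ^ 2 * d ^ 2 = _ := (jacobi_identities z hσ).2
      have hJ4 : jacobiTheta₂ (z + 1 / 2) (2 * τ) ^ 2 * d ^ 2 = _ := (jacobi_identities z hσ).1
      rw [A, theta1_eq, neg_sq, e, hs, ← hJ1, ← hJ4, ← hd4']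
      generalize thetaTwo (z + 1 / 2) (2 * τ) = u
      generalize jacobiTheta₂ (z + 1 / 2) (2 * τ) = v
      field_simp
      ring
    rw [h1, hA, hB, hE2]
    field_simp
    ring
  · have h2 : theta2 τ z ^ 2 / theta2 τ 0 ^ 2 =
        thetaTwo z (2 * τ) ^ 2 * jacobiTheta₂ z (2 * τ) ^ 2 / (a ^ 2 * b ^ 2) := by
      rw [theta2_eq, theta2_eq, ← div_pow, ← mul_div_mul_right _ _ hT2,
        ← pow_two (thetaTwo 0 _), t2, thetaTwo_mul_zero z hτ]
      field_simp
    have h3 : theta3 τ z ^ 2 / theta3 τ 0 ^ 2 =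
        ((jacobiTheta₂ z (2 * τ) ^ 2 + thetaTwo z (2 * τ) ^ 2) / (b ^ 2 + a ^ 2)) ^ 2 := by
      rw [theta3_eq, theta3_eq, ← div_pow, ← mul_div_mul_right _ _ hT3,
        ← pow_two (jacobiTheta₂ 0 _), t3, jacobiTheta₂_mul_zero z hτ]
    have h4 : theta4 τ z ^ 2 / theta4 τ 0 ^ 2 =
        ((jacobiTheta₂ z (2 * τ) ^ 2 - thetaTwo z (2 * τ) ^ 2) / (b ^ 2 - a ^ 2)) ^ 2 := by
      rw [theta4_eq, theta4_eq, zero_add, ← div_pow, ← mul_div_mul_right _ _ hT4,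
        ← pow_two (jacobiTheta₂ (1 / 2) _), t4, jacobiTheta₂_add_half_mul_half z hτ]
    rw [B, h2, h3, h4, hA, hB, hE2, hE4]
    field_simp
    ring
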